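/- Let $F_2$ be the free group on two generators $x_1,x_2$ and let $\operatorname{Out}(F_2)\to\operatorname{GL}_2(\mathbb{Z})$ be the homomorphism induced by the abelianization $F_2\to\mathbb{Z}^2$ (the class of $\sigma$ is sent to the matrix whose $j$-th column is the image of $\sigma(x_j)$ in $\mathbb{Z}^2$). For a group $G$, let $\operatorname{Epi}^{\mathrm{ext}}(F_2,G)$ be the set of surjective homomorphisms $F_2\to G$ modulo conjugation in $G$; the group $\operatorname{Out}(F_2)$ acts on it on the left by $[\sigma]\cdot[\varphi]=[\varphi\circ\sigma^{-1}]$. Let $G$ be a finite metabelian group (that is, its commutator subgroup is abelian) which can be generated by two elements. Then every $\gamma\in\operatorname{SL}_2(\mathbb{Z})\subset\operatorname{GL}_2(\mathbb{Z})$ is the image of some $o\in\operatorname{Out}(F_2)$, and there is a left action of $\operatorname{SL}_2(\mathbb{Z})$ on $\operatorname{Epi}^{\mathrm{ext}}(F_2,G)$ such that $\gamma\cdot c=o\cdot c$ for all $c\in\operatorname{Epi}^{\mathrm{ext}}(F_2,G)$, all $\gamma\in\operatorname{SL}_2(\mathbb{Z})$ and all $o\in\operatorname{Out}(F_2)$ with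 image $\gamma$. Moreover, for every surjective homomorphism $\varphi:F_2\to G$, the stabilizer $\Gamma_\varphi\subset\operatorname{SL}_2(\mathbb{Z})$ of the conjugacy class of $\varphi$ is a congruence subgroup, i.e. it contains $\Gamma(n)=\ker(\operatorname{SL}_2(\mathbb{Z})\to\operatorname{SL}_2(\mathbb{Z}/n))$ for some $n\ge 1$. -/

import Mathlib

open scoped MatrixGroups

/-- The subgroup `Inn(B)` of inner automorphisms of `B`. -/
abbrev Inn (B : Type*) [Group B] : Subgroup (MulAut B) :=
  (MulAut.conj : B →* MulAut B).range

instance Inn.normal (B : Type*) [Group B] : (Inn B).Normal where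
  conj_mem := by
    rintro _ ⟨b, rfl⟩ σ
    refine ⟨σ b, ?_⟩
    ext x
    simp [MulAut.mul_apply, MulAut.conj_apply]

/-- The outer automorphism group `Out(B) = Aut(B) / Inn(B)`. -/
abbrev OuterAut (B : Type*) [Group B] : Type _ := MulAut B ⧸ Inn B

/-- Two surjections `B → G` are equivalent if they differ by an inner automorphism of `G`. -/
def epiSetoid (B G : Type*) [Group B] [Group G] :
    Setoid {φ : B →* G // Function.Surjective φ} where
  r φ ψ := ∃ g : G, ∀ b : B, ψ.1 b = g * φ.1 b * g⁻¹
  iseqv :=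
    { refl := fun φ => ⟨1, fun b => by simp⟩
      symm := by
        rintro φ ψ ⟨g, h⟩
        refine ⟨g⁻¹, fun b => ?_⟩
        rw [h b]
        group
      trans := by
        rintro φ ψ χ ⟨g, h⟩ ⟨k, h'⟩
        refine ⟨k * g, fun b => ?_⟩
        rw [h' b, h b]
        group }

/-- `Epi^ext(B, G)`: the set of surjective homomorphisms `B → G` modulo conjugation in `G`. -/
def EpiExt (B G : Type*) [Group B] [Group G] : Type _ := Quotient (epiSetoid B G)

namespace EpiExt

variable {B G : Type*} [Group B] [Group G]

/-- The conjugacy class of a surjective homomorphism. -/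
def mk (φ : B →* G) (hφ : Function.Surjective φ) : EpiExt B G :=
  Quotient.mk (epiSetoid B G) ⟨φ, hφ⟩

/-- `Aut(B)` acts on `Epi^ext(B, G)` on the left by `σ • [φ] = [φ ∘ σ⁻¹]`. -/
instance autAction : MulAction (MulAut B) (EpiExt B G) where
  smul σ := Quotient.map' (s₁ := epiSetoid B G) (s₂ := epiSetoid B G)
    (fun φ => ⟨φ.1.comp (σ⁻¹ : MulAut B).toMonoidHom,
      φ.2.comp (MulEquiv.surjective (σ⁻¹ : MulAut B))⟩)
    (by
      rintro φ ψ ⟨g, h⟩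
      exact ⟨g, fun b => h _⟩)
  one_smul := by
    rintro ⟨φ⟩
    rfl
  mul_smul := by
    rintro σ τ ⟨φ⟩
    change Quotient.mk (epiSetoid B G) _ = Quotient.mk (epiSetoid B G) _
    congr 1

theorem aut_smul_mk (σ : MulAut B) (φ : B →* G) (hφ : Function.Surjective φ) :
    σ • mk φ hφ = mk (φ.comp (σ⁻¹ : MulAut B).toMonoidHom)
      (hφ.comp (MulEquiv.surjective (σ⁻¹ : MulAut B))) := rfl

theorem inn_le_ker :
    Inn B ≤ (MulAction.toPermHom (MulAut B) (EpiExt B G)).ker := by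
  rintro _ ⟨b, rfl⟩
  rw [MonoidHom.mem_ker]
  ext x
  obtain ⟨φ⟩ := x
  change Quotient.mk (epiSetoid B G) _ = Quotient.mk (epiSetoid B G) _
  refine Quotient.sound ⟨φ.1 b, fun c => ?_⟩
  have h : ((MulAut.conj b)⁻¹ : MulAut B) c = b⁻¹ * c * b := by
    rw [← map_inv, MulAut.conj_apply, inv_inv]
  change φ.1 c = φ.1 b * φ.1 (((MulAut.conj b)⁻¹ : MulAut B) c) * (φ.1 b)⁻¹
  rw [h, map_mul, map_mul, map_inv]
  group

/-- Inner automorphisms act trivially on `Epi^ext(B, G)`, so the action of `Aut(B)` descends to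
`Out(B)`. -/
instance outAction : MulAction (OuterAut B) (EpiExt B G) :=
  MulAction.compHom (EpiExt B G)
    (QuotientGroup.lift (Inn B) (MulAction.toPermHom (MulAut B) (EpiExt B G)) inn_le_ker)

theorem out_smul (σ : MulAut B) (x : EpiExt B G) :
    (QuotientGroup.mk σ : OuterAut B) • x = σ • x := rfl

end EpiExt

/-- The free group of rank 2. -/
abbrev F₂ : Type := FreeGroup (Fin 2)

/-- The abelianization map `F₂ → ℤ²`, sending the `i`-th free generator to the `i`-th standard
basis vector. -/
def F₂.ab : F₂ →* Multiplicative (Fin 2 → ℤ) :=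
  FreeGroup.lift fun i => Multiplicative.ofAdd (Pi.single i 1)

/-- The matrix (acting on column vectors) of the endomorphism of `ℤ²` induced by `σ`: its `j`-th
column is the abelianization of `σ (x_j)`. -/
def F₂.abMatrix (σ : F₂ →* F₂) : Matrix (Fin 2) (Fin 2) ℤ :=
  Matrix.of fun i j => (F₂.ab (σ (FreeGroup.of j))).toAdd i

theorem F₂.abMatrix_mulVec (σ : F₂ →* F₂) (w : F₂) :
    (F₂.ab (σ w)).toAdd = (F₂.abMatrix σ).mulVec (F₂.ab w).toAdd := by
  have h : F₂.ab.comp σ =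
      (AddMonoidHom.toMultiplicative (F₂.abMatrix σ).mulVecLin.toAddMonoidHom).comp F₂.ab := by
    refine FreeGroup.ext_hom _ _ fun j => ?_
    apply Multiplicative.toAdd.injective
    ext i
    simp [F₂.ab, F₂.abMatrix]
  exact congrArg Multiplicative.toAdd (DFunLike.congr_fun h w)

theorem F₂.abMatrix_comp (σ τ : F₂ →* F₂) :
    F₂.abMatrix (σ.comp τ) = F₂.abMatrix σ * F₂.abMatrix τ := by
  ext i j
  exact congrFun (F₂.abMatrix_mulVec σ (τ (FreeGroup.of j))) i

theorem F₂.abMatrix_id : F₂.abMatrix (MonoidHom.id F₂) = 1 := by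
  ext i j
  simp [F₂.ab, F₂.abMatrix, Matrix.one_apply, Pi.single_apply]

/-- The homomorphism `Aut(F₂) → GL₂(ℤ)` induced by abelianization. -/
def F₂.autToGL : MulAut F₂ →* GL (Fin 2) ℤ :=
  MonoidHom.toHomUnits
    { toFun := fun σ => F₂.abMatrix σ.toMonoidHom
      map_one' := F₂.abMatrix_id
      map_mul' := fun σ τ => F₂.abMatrix_comp σ.toMonoidHom τ.toMonoidHom }

theorem F₂.inn_le_ker : Inn F₂ ≤ F₂.autToGL.ker := by
  rintro _ ⟨w, rfl⟩
  rw [MonoidHom.mem_ker]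
  apply Units.ext
  ext i j
  have h : F₂.ab (MulAut.conj w (FreeGroup.of j)) = F₂.ab (FreeGroup.of j) := by
    rw [MulAut.conj_apply, map_mul, map_mul, map_inv, mul_comm, inv_mul_cancel_left]
  have h' := congrFun (congrArg Multiplicative.toAdd h) i
  refine h'.trans ?_
  exact congrFun (congrFun F₂.abMatrix_id i) j

/-- The canonical homomorphism `Out(F₂) → GL₂(ℤ)` induced by abelianization. -/
def F₂.outToGL : OuterAut F₂ →* GL (Fin 2) ℤ :=
  QuotientGroup.lift (Inn F₂) F₂.autToGL F₂.inn_le_ker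

/-- A group is metabelian if its commutator subgroup is abelian. -/
def IsMetabelian (G : Type*) [Group G] : Prop :=
  ∀ a ∈ commutator G, ∀ b ∈ commutator G, a * b = b * a

/-! Let `A = ℤ[ℤ²]` and `c = [x₀, x₁]`. The group `F₂'/F₂''` is a free `A`-module on the class of
`c`, and the coordinate `a` of `w` is read off the Fox derivative: `fox w = a * (X 0 - 1)`
(`exists_coord`, `eq_of_coord`). A homomorphism `φ : F₂ → G` to a metabelian group makes `G'` an
`A`-module (`eval`).

An automorphism over `γ ∈ SL₂(ℤ)` sends `c` to a conjugate of `c` modulo `F₂''`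
(`exists_fox_comm₂`): the generators `S` and `T` have lifts fixing `c`, and an automorphism trivial
on `ℤ²` multiplies `c` by a unit of augmentation one, which is a monomial. So, up to an inner
automorphism, `σ` fixes the class of `c`.

Write `σ x₀ = u x₀^p x₁^q` and `σ x₁ = v x₀^p' x₁^q'`, with `e`, `f` the coordinates of `u`, `v`.
Fixing `c` is then a single equation in `A`. If `γ ≡ 1` modulo `|G|³`, it reduces to `(1 - X 1) e +
(X 0 - 1) f ≡ 0`, and Koszul exactness (`exists_koszul`) gives one `k` with `e ≡ (X 0 - 1) k` and `f
≡ (X 1 - 1) k` modulo the annihilator of `G'`. This says that `φ ∘ σ` is a conjugate of `φ` by an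
element of `G'` (`exists_conj_of_congr_one`). Hence lifts of `Γ(|G|³)` fix every class; the case `γ
= 1` makes the action of `SL₂(ℤ)` well defined. -/

/-- The integral group ring of `ℤ²`. -/
abbrev LaurentRing : Type := MonoidAlgebra ℤ (Multiplicative (Fin 2 → ℤ))

/-! ### Divisibility and units in the group ring of `ℤ²`. -/

namespace LaurentRing

/-- The monomial attached to the abelianization of a word. -/
noncomputable def mon : F₂ →* LaurentRing := (MonoidAlgebra.of ℤ _).comp F₂.ab

/-- The variables of the Laurent ring. -/
noncomputable abbrev X (i : Fin 2) : LaurentRing := mon (FreeGroup.of i)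

theorem mon_isUnit (w : F₂) : IsUnit (mon w) := (Group.isUnit w).map mon

theorem mon_inv_mul (w : F₂) : mon w⁻¹ * mon w = 1 := by
  rw [← map_mul, inv_mul_cancel, map_one]

theorem mon_eq_of {w : F₂} : mon w = MonoidAlgebra.of ℤ _ (F₂.ab w) := rfl

theorem _root_.F₂.ab_of (i : Fin 2) :
    F₂.ab (FreeGroup.of i) = Multiplicative.ofAdd (Pi.single i 1) := by
  simp [F₂.ab]

theorem mon_injective_ab {v w : F₂} (h : mon v = mon w) : F₂.ab v = F₂.ab w :=
  MonoidAlgebra.of_injective h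

theorem X_sub_one_ne_zero (i : Fin 2) : X i - 1 ≠ 0 := by
  intro h
  have h1 : mon (FreeGroup.of i) = mon 1 := by rw [map_one]; exact sub_eq_zero.1 h
  have h2 := congrArg (fun z : Multiplicative (Fin 2 → ℤ) => z.toAdd i) (mon_injective_ab h1)
  simp [F₂.ab] at h2

theorem sub_one_dvd_zpow_sub_one {G R : Type*} [Group G] [CommRing R] (χ : G →* R) (g : G)
    (n : ℤ) : χ g - 1 ∣ χ (g ^ n) - 1 := by
  have key (k : ℕ) : χ g - 1 ∣ χ (g ^ k) - 1 := by
    rw [map_pow]; exact sub_one_dvd_pow_sub_one _ _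
  obtain ⟨k, rfl | rfl⟩ := n.eq_nat_or_neg
  · simpa using key k
  · have h : χ (g ^ (-(k : ℤ))) * χ (g ^ k) = 1 := by rw [← map_mul]; simp
    have : χ (g ^ (-(k : ℤ))) - 1 = -χ (g ^ (-(k : ℤ))) * (χ (g ^ k) - 1) := by
      linear_combination h
    rw [this]
    exact (key k).mul_left _

/-- Setting the exponent of the `i`-th variable to zero. -/
def forget (i : Fin 2) : Multiplicative (Fin 2 → ℤ) →* Multiplicative (Fin 2 → ℤ) :=
  AddMonoidHom.toMultiplicative
    { toFun := fun z => Function.update z i 0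
      map_zero' := by ext j; by_cases h : j = i <;> simp [Function.update, h]
      map_add' := fun a b => by ext j; by_cases h : j = i <;> simp [Function.update, h] }

/-- The substitution `X i = 1`. -/
noncomputable def specialize (i : Fin 2) : LaurentRing →+* LaurentRing :=
  MonoidAlgebra.mapDomainRingHom ℤ (forget i)

theorem specialize_of (i : Fin 2) (z : Multiplicative (Fin 2 → ℤ)) :
    specialize i (MonoidAlgebra.of ℤ _ z) = MonoidAlgebra.of ℤ _ (forget i z) := by
  simp [specialize]

theorem specialize_X_self (i : Fin 2) : specialize i (X i) = 1 := by
  rw [X, mon_eq_of, specialize_of, ← map_one (MonoidAlgebra.of ℤ _)]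
  congr 1
  apply Multiplicative.toAdd.injective
  ext j
  by_cases h : j = i <;> simp [forget, F₂.ab_of, Function.update, h]

theorem specialize_X_of_ne {i j : Fin 2} (hij : j ≠ i) : specialize i (X j) = X j := by
  rw [X, mon_eq_of, specialize_of]
  congr 1
  apply Multiplicative.toAdd.injective
  ext l
  by_cases h : l = i
  · subst h; simp [forget, F₂.ab_of, Function.update, hij.symm]
  · simp [forget, F₂.ab_of, Function.update, h]

/-- By additivity only monomials matter, where this is `X - 1 ∣ X ^ n - 1` for `n ∈ ℤ`. In
particular an element killed by `X i = 1` is a multiple of `X i - 1`. -/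
theorem X_sub_one_dvd_sub_specialize (i : Fin 2) (a : LaurentRing) :
    X i - 1 ∣ a - specialize i a := by
  induction a using MonoidAlgebra.induction_on with
  | of z =>
    have hz : z = F₂.ab (FreeGroup.of i) ^ (z.toAdd i) * forget i z := by
      apply Multiplicative.toAdd.injective
      ext l
      by_cases h : l = i
      · subst h; simp [forget, F₂.ab_of]
      · simp [forget, F₂.ab_of, Function.update, h]
    have h1 : MonoidAlgebra.of ℤ _ z - specialize i (MonoidAlgebra.of ℤ _ z)
        = (mon (FreeGroup.of i ^ (z.toAdd i)) - 1) * MonoidAlgebra.of ℤ _ (forget i z) := by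
      rw [specialize_of, sub_mul, one_mul, mon_eq_of, ← map_mul, map_zpow, ← hz]
    rw [h1]
    exact (sub_one_dvd_zpow_sub_one mon _ _).mul_right _
  | add a b ha hb =>
    rw [map_add, add_sub_add_comm]; exact dvd_add ha hb
  | smul r a ha =>
    rw [map_zsmul, ← smul_sub, zsmul_eq_mul]; exact ha.mul_left _

/-- The augmentation map. -/
noncomputable def aug : LaurentRing →+* ℤ :=
  (MonoidAlgebra.lift ℤ ℤ (Multiplicative (Fin 2 → ℤ)) 1).toRingHom

theorem aug_of (z : Multiplicative (Fin 2 → ℤ)) : aug (MonoidAlgebra.of ℤ _ z) = 1 := by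
  simp [aug]

theorem aug_mon (w : F₂) : aug (mon w) = 1 := aug_of _

theorem aug_single (z : Multiplicative (Fin 2 → ℤ)) (n : ℤ) :
    aug (MonoidAlgebra.single z n) = n := by
  simp [aug]

/-- `X i - 1` and `X j - 1` form a regular sequence modulo any nonzero integer. -/
theorem exists_of_mul_eq {i j : Fin 2} (hij : j ≠ i) {m : ℤ} (hm : m ≠ 0) {a b r : LaurentRing}
    (h : (X j - 1) * a = (X i - 1) * b + (m : LaurentRing) * r) :
    ∃ k a' b', a = (X i - 1) * k + (m : LaurentRing) * a' ∧
      b = (X j - 1) * k + (m : LaurentRing) * b' := by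
  have hm' : (m : LaurentRing) ≠ 0 := fun h0 => hm (by simpa using congrArg aug h0)
  have e1 : (X j - 1) * specialize i a = (m : LaurentRing) * specialize i r := by
    have := congrArg (specialize i) h
    simpa [specialize_X_self, specialize_X_of_ne hij] using this
  -- Setting both variables to one kills the left side of `e1`, and `m` can be cancelled. So `X j -
  -- 1` divides `r` at `X i = 1`, and it cancels from `e1` in turn.
  have e2 : specialize j (specialize i r) = 0 := by
    have := congrArg (specialize j) e1
    simp only [map_mul, map_sub, specialize_X_self, map_one, sub_self, zero_mul,
      map_intCast] at this
    exact (mul_eq_zero.1 this.symm).resolve_left hm'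
  obtain ⟨a', ha'⟩ := X_sub_one_dvd_sub_specialize j (specialize i r)
  rw [e2, sub_zero] at ha'
  have e3 : specialize i a = m * a' := by
    apply mul_left_cancel₀ (X_sub_one_ne_zero j)
    rw [e1, ha']; ring
  obtain ⟨k, hk⟩ := X_sub_one_dvd_sub_specialize i a
  have e4 : (X i - 1) * (b - (X j - 1) * k) = m * ((X j - 1) * a' - r) := by
    rw [e3] at hk
    linear_combination -h + (X j - 1) * hk
  have e5 : specialize i ((X j - 1) * a' - r) = 0 := by
    have := congrArg (specialize i) e4
    simp only [map_mul, map_sub, specialize_X_self, map_one, sub_self, zero_mul,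
      map_intCast] at this ⊢
    exact (mul_eq_zero.1 this.symm).resolve_left hm'
  obtain ⟨b', hb'⟩ := X_sub_one_dvd_sub_specialize i ((X j - 1) * a' - r)
  rw [e5, sub_zero] at hb'
  refine ⟨k, a', b', ?_, ?_⟩
  · rw [e3] at hk; linear_combination hk
  · apply mul_left_cancel₀ (X_sub_one_ne_zero i)
    linear_combination e4 + m * hb'

/-- A unit of augmentation one is a monomial. -/
theorem eq_of_of_mul_eq_one {a b : LaurentRing} (hab : a * b = 1) (ha : aug a = 1) :
    ∃ z, a = MonoidAlgebra.of ℤ _ z := by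
  have hcoeff {p : Multiplicative (Fin 2 → ℤ) × Multiplicative (Fin 2 → ℤ)}
      (hp : p ∈ a.coeff.support ×ˢ b.coeff.support)
      (hu : UniqueMul a.coeff.support b.coeff.support p.1 p.2) : p.1 * p.2 = 1 := by
    by_contra hne
    have h := MonoidAlgebra.coeff_mul_mul_of_uniqueMul hu
    rw [Finset.mem_product, Finsupp.mem_support_iff, Finsupp.mem_support_iff] at hp
    rw [hab, MonoidAlgebra.one_def, MonoidAlgebra.coeff_single, Finsupp.single_eq_of_ne hne] at h
    exact mul_ne_zero hp.1 hp.2 h.symm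
  -- `ℤ²` has two unique products: otherwise two distinct pairs would contribute uncancelled terms
  -- to `a * b = 1`. Both products would then be the identity, against uniqueness.
  have hcard : ¬ 1 < a.coeff.support.card * b.coeff.support.card := by
    intro hlt
    obtain ⟨p, hp, q, hq, hne, hup, huq⟩ := TwoUniqueProds.uniqueMul_of_one_lt_card hlt
    have hq' := Finset.mem_product.1 hq
    have h := hup hq'.1 hq'.2 ((hcoeff hq huq).trans (hcoeff hp hup).symm)
    exact hne (Prod.ext h.1 h.2).symm
  have hb0 : b ≠ 0 := by rintro rfl; simp at hab
  have hbc : 0 < b.coeff.support.card := by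
    rw [Finset.card_pos, Finsupp.support_nonempty_iff]
    simpa using hb0
  have hac : a.coeff.support.card ≤ 1 := by
    by_contra! hlt
    exact hcard (lt_of_lt_of_le hlt (Nat.le_mul_of_pos_right _ hbc))
  obtain ⟨z, hz⟩ := Finsupp.card_support_le_one.1 hac
  have hz' : a = MonoidAlgebra.single z (a.coeff z) := by
    apply MonoidAlgebra.coeff_injective
    simpa using hz
  refine ⟨z, ?_⟩
  rw [hz', aug_single] at ha
  rw [hz', ha, MonoidAlgebra.of_apply]

end LaurentRing


/-! ### Fox calculus and the module `F₂'/F₂''`. -/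

namespace F₂

open LaurentRing
open scoped commutatorElement

/-- The affine action of the free group on the Laurent ring through which the Fox derivative is
defined. -/
noncomputable def foxHom : F₂ →* Equiv.Perm LaurentRing :=
  FreeGroup.lift ![(mon_isUnit (FreeGroup.of 0)).unit.mulLeft,
    ((mon_isUnit (FreeGroup.of 1)).unit.mulLeft).trans (Equiv.addRight 1)]

/-- The Fox derivative with respect to the second generator, with abelianized values. -/
noncomputable def fox (w : F₂) : LaurentRing := foxHom w 0

theorem foxHom_apply (w : F₂) (r : LaurentRing) : foxHom w r = mon w * r + fox w := by
  have hof (i : Fin 2) (r : LaurentRing) :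
      foxHom (FreeGroup.of i) r = X i * r + fox (FreeGroup.of i) := by
    fin_cases i <;> simp [fox, foxHom]
  induction w using FreeGroup.induction_on generalizing r with
  | C1 => simp [fox]
  | of i => exact hof i r
  | inv_of i _ =>
    apply (foxHom (FreeGroup.of i)).injective
    have h0 := hof i (fox (FreeGroup.of i)⁻¹)
    have h1 : mon (FreeGroup.of i) * mon (FreeGroup.of i)⁻¹ = 1 := by rw [← map_mul]; simp
    have h2 : foxHom (FreeGroup.of i) (fox (FreeGroup.of i)⁻¹) = 0 := by
      rw [fox, ← Equiv.Perm.mul_apply, ← map_mul, mul_inv_cancel, map_one, Equiv.Perm.one_apply]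
    rw [← Equiv.Perm.mul_apply, ← map_mul, mul_inv_cancel, map_one, Equiv.Perm.one_apply, hof]
    linear_combination h0 - h2 - r * h1
  | mul v w hv hw =>
    have h (r) : foxHom (v * w) r = mon (v * w) * r + (mon v * fox w + fox v) := by
      rw [map_mul, Equiv.Perm.mul_apply, hw, hv, map_mul]; ring
    have h0 := h 0
    rw [mul_zero, zero_add] at h0
    rw [h r, ← h0, fox]

theorem fox_mul (v w : F₂) : fox (v * w) = fox v + mon v * fox w := by
  rw [fox, map_mul, Equiv.Perm.mul_apply, foxHom_apply v, add_comm]; rfl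

theorem fox_one : fox 1 = 0 := by simp [fox]

theorem fox_inv (w : F₂) : fox w⁻¹ = -(mon w⁻¹ * fox w) := by
  have h := fox_mul w⁻¹ w
  rw [inv_mul_cancel, fox_one] at h
  linear_combination -h

theorem fox_of_zero : fox (FreeGroup.of 0) = 0 := by simp [fox, foxHom]

theorem fox_of_one : fox (FreeGroup.of 1) = 1 := by simp [fox, foxHom]

theorem mon_commutator (v w : F₂) : mon ⁅v, w⁆ = 1 := by
  rw [mon_eq_of, map_commutatorElement, commutatorElement_eq_one_iff_mul_comm.2 (mul_comm _ _),
    map_one]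

theorem fox_commutator (v w : F₂) :
    fox ⁅v, w⁆ = (1 - mon w) * fox v + (mon v - 1) * fox w := by
  have h : ⁅v, w⁆ * (w * v) = v * w := by rw [commutatorElement_def]; group
  have h1 := congrArg fox h
  rw [fox_mul, fox_mul, fox_mul, mon_commutator] at h1
  linear_combination h1

/-- The basic commutator. -/
abbrev comm₂ : F₂ := ⁅(FreeGroup.of 0 : F₂), FreeGroup.of 1⁆

theorem fox_comm₂ : fox comm₂ = X 0 - 1 := by
  rw [fox_commutator, fox_of_zero, fox_of_one]; ring

theorem fox_conj (v w : F₂) (hw : mon w = 1) : fox (v * w * v⁻¹) = mon v * fox w := by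
  rw [fox_mul, fox_mul, fox_inv, map_mul, hw]
  have : mon v * mon v⁻¹ = 1 := by rw [← map_mul]; simp
  linear_combination -fox v * this


theorem mem_commutator_iff {w : F₂} : w ∈ commutator F₂ ↔ F₂.ab w = 1 := by
  constructor
  · exact fun h => Abelianization.commutator_subset_ker F₂.ab h
  · intro h
    let a (i : Fin 2) : Abelianization F₂ := Abelianization.of (FreeGroup.of i)
    let ψ : Multiplicative (Fin 2 → ℤ) →* Abelianization F₂ :=
      { toFun := fun z => a 0 ^ z.toAdd 0 * a 1 ^ z.toAdd 1
        map_one' := by simp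
        map_mul' := fun y z => by
          simp only [toAdd_mul, Pi.add_apply, zpow_add]
          exact mul_mul_mul_comm _ _ _ _ }
    have hψ : ψ.comp F₂.ab = Abelianization.of := by
      refine FreeGroup.ext_hom _ _ fun i => ?_
      fin_cases i <;> simp [ψ, F₂.ab, a]
    have h1 : Abelianization.of w = 1 := by
      rw [← hψ, MonoidHom.comp_apply, h, map_one]
    rwa [← MonoidHom.mem_ker, Abelianization.ker_of] at h1

theorem mem_commutator_iff_mon {w : F₂} : w ∈ commutator F₂ ↔ mon w = 1 := by
  rw [mem_commutator_iff, mon_eq_of, ← map_one (MonoidAlgebra.of ℤ _),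
    MonoidAlgebra.of_injective.eq_iff]

/-- Modulo the normal closure the two generators commute, so the quotient is abelian. -/
theorem commutator_eq_normalClosure : commutator F₂ = Subgroup.normalClosure {comm₂} := by
  apply le_antisymm
  · set K := Subgroup.normalClosure {comm₂}
    have hc : (QuotientGroup.mk (FreeGroup.of 0) : F₂ ⧸ K) * QuotientGroup.mk (FreeGroup.of 1) =
        QuotientGroup.mk (FreeGroup.of 1) * QuotientGroup.mk (FreeGroup.of 0) := by
      rw [← commutatorElement_eq_one_iff_mul_comm]
      exact (QuotientGroup.eq_one_iff (N := K) comm₂).2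
        (Subgroup.subset_normalClosure (Set.mem_singleton _))
    have hcomm (i : Fin 2) (w : F₂) : Commute (QuotientGroup.mk (FreeGroup.of i) : F₂ ⧸ K)
        (QuotientGroup.mk w) := by
      induction w using FreeGroup.induction_on with
      | C1 => exact Commute.one_right _
      | of j =>
        fin_cases i <;> fin_cases j
        · exact Commute.refl _
        · exact hc
        · exact hc.symm
        · exact Commute.refl _
      | inv_of j h => exact h.inv_right
      | mul v w hv hw => exact hv.mul_right hw
    have hcomm' (v w : F₂) : Commute (QuotientGroup.mk v : F₂ ⧸ K) (QuotientGroup.mk w) := by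
      induction v using FreeGroup.induction_on with
      | C1 => exact Commute.one_left _
      | of i => exact hcomm i w
      | inv_of j h => exact h.inv_left
      | mul v w hv hw => exact hv.mul_left hw
    rw [commutator_def, Subgroup.commutator_le]
    intro v _ w _
    rw [← QuotientGroup.eq_one_iff (N := K)]
    exact commutatorElement_eq_one_iff_mul_comm.2 (hcomm' v w)
  · exact Subgroup.normalClosure_le_normal
      (Set.singleton_subset_iff.2 (Subgroup.commutator_mem_commutator trivial trivial))

/-- The derived subgroup modulo its own derived subgroup is a free module of rank one over the
Laurent ring: an equivariant homomorphism on it is determined by its value at `comm₂`. -/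
theorem exists_coord {B : Type*} [AddCommGroup B] (ev : LaurentRing →+* AddMonoid.End B)
    (δ : commutator F₂ →* Multiplicative B)
    (hδ : ∀ (g : F₂) (w w' : commutator F₂), (w' : F₂) = g * w * g⁻¹ →
      (δ w').toAdd = ev (mon g) (δ w).toAdd) (c : commutator F₂) (hc : (c : F₂) = comm₂)
    (w : commutator F₂) :
    ∃ a, fox w = a * (X 0 - 1) ∧ (δ w).toAdd = ev a (δ c).toAdd := by
  obtain ⟨w, hw⟩ := w
  have hw' := hw
  rw [commutator_eq_normalClosure, Subgroup.normalClosure] at hw'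
  induction hw' using Subgroup.closure_induction with
  | mem v hv =>
    obtain ⟨_, rfl, hv⟩ := Group.mem_conjugatesOfSet_iff.1 hv
    obtain ⟨g, rfl⟩ := isConj_iff.1 hv
    exact ⟨mon g, by rw [fox_conj _ _ (mon_commutator _ _), fox_comm₂], hδ g c _ (by rw [hc])⟩
  | one => exact ⟨0, by simp [fox_one], by
      have : (⟨1, hw⟩ : commutator F₂) = 1 := rfl
      rw [this, map_one, map_zero]; rfl⟩
  | mul u v hu hv ihu ihv =>
    have hu' : u ∈ commutator F₂ := by rw [commutator_eq_normalClosure]; exact hu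
    have hv' : v ∈ commutator F₂ := by rw [commutator_eq_normalClosure]; exact hv
    obtain ⟨a, ha, ha'⟩ := ihu hu'
    obtain ⟨b, hb, hb'⟩ := ihv hv'
    refine ⟨a + b, ?_, ?_⟩
    · simp only at ha hb ⊢
      rw [fox_mul, mem_commutator_iff_mon.1 hu', ha, hb]; ring
    · have : (⟨u * v, hw⟩ : commutator F₂) = ⟨u, hu'⟩ * ⟨v, hv'⟩ := rfl
      rw [this, map_mul, toAdd_mul, ha', hb', map_add]; rfl
  | inv u hu ihu =>
    have hu' : u ∈ commutator F₂ := by rw [commutator_eq_normalClosure]; exact hu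
    obtain ⟨a, ha, ha'⟩ := ihu hu'
    refine ⟨-a, ?_, ?_⟩
    · simp only at ha ⊢
      rw [fox_inv, mem_commutator_iff_mon.1 (inv_mem hu'), ha]; ring
    · have : (⟨u⁻¹, hw⟩ : commutator F₂) = ⟨u, hu'⟩⁻¹ := rfl
      rw [this, map_inv, toAdd_inv, ha', map_neg]; rfl

/-- The coordinate is unique because `X 0 - 1` is not a zero divisor, so any `a` computed from the
Fox derivative may be used. -/
theorem eq_of_coord {B : Type*} [AddCommGroup B] (ev : LaurentRing →+* AddMonoid.End B)
    (δ : commutator F₂ →* Multiplicative B)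
    (hδ : ∀ (g : F₂) (w w' : commutator F₂), (w' : F₂) = g * w * g⁻¹ →
      (δ w').toAdd = ev (mon g) (δ w).toAdd) (c : commutator F₂) (hc : (c : F₂) = comm₂)
    (w : commutator F₂) {a : LaurentRing} (ha : fox w = a * (X 0 - 1)) :
    (δ w).toAdd = ev a (δ c).toAdd := by
  obtain ⟨b, hb, hb'⟩ := exists_coord ev δ hδ c hc w
  rwa [mul_right_cancel₀ (X_sub_one_ne_zero 0) (ha.symm.trans hb)]

theorem comm₂_mem : comm₂ ∈ commutator F₂ :=
  Subgroup.commutator_mem_commutator trivial trivial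

theorem exists_fox_eq {w : F₂} (hw : w ∈ commutator F₂) : ∃ a, fox w = a * (X 0 - 1) := by
  -- Only the divisibility half is wanted, so the trivial homomorphism serves as `δ`.
  obtain ⟨a, ha, -⟩ := exists_coord (B := LaurentRing) (Module.toAddMonoidEnd _ _) 1
    (by simp) ⟨_, comm₂_mem⟩ rfl ⟨w, hw⟩
  exact ⟨a, ha⟩

end F₂


/-! ### Automorphisms of `F₂` and the basic commutator. -/

namespace F₂

open LaurentRing
open scoped commutatorElement

theorem exists_ab_eq (z : Multiplicative (Fin 2 → ℤ)) :
    ∃ g : F₂, F₂.ab g = z := by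
  refine ⟨FreeGroup.of 0 ^ z.toAdd 0 * FreeGroup.of 1 ^ z.toAdd 1, ?_⟩
  apply Multiplicative.toAdd.injective
  ext l
  fin_cases l <;> simp [F₂.ab_of]

theorem abMatrix_of_autToGL {σ : MulAut F₂} {g : GL (Fin 2) ℤ} (h : F₂.autToGL σ = g) :
    F₂.abMatrix σ.toMonoidHom = g := congrArg Units.val h

theorem ab_apply_of_autToGL_eq_one {σ : MulAut F₂} (h : F₂.autToGL σ = 1) (w : F₂) :
    F₂.ab (σ w) = F₂.ab w := by
  apply Multiplicative.toAdd.injective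
  have := F₂.abMatrix_mulVec σ.toMonoidHom w
  rw [abMatrix_of_autToGL h, Units.val_one, Matrix.one_mulVec] at this
  exact this

/-- The Fox derivative twisted by an automorphism acting trivially on the abelianization. -/
noncomputable def twistedFox (σ : MulAut F₂) (h : F₂.autToGL σ = 1) :
    commutator F₂ →* Multiplicative LaurentRing where
  toFun w := Multiplicative.ofAdd (fox (σ w))
  map_one' := by simp [fox_one]
  map_mul' v w := by
    have : mon (σ v) = 1 := by
      rw [mon_eq_of, ab_apply_of_autToGL_eq_one h, ← mon_eq_of, mem_commutator_iff_mon.1 v.2]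
    rw [Subgroup.coe_mul, map_mul, fox_mul, this, one_mul, ofAdd_add]

/-- Since `σ` is trivial on `ℤ²`, it acts `A`-linearly on `F₂'/F₂''`, so it is multiplication by the
coordinate of `σ comm₂`. -/
theorem twistedFox_eq_mul {σ : MulAut F₂} (h : F₂.autToGL σ = 1) {w : F₂}
    (hw : w ∈ commutator F₂) {a : LaurentRing} (ha : fox w = a * (X 0 - 1)) :
    fox (σ w) = a * fox (σ comm₂) := by
  have hm (v : F₂) : mon (σ v) = mon v := by
    rw [mon_eq_of, ab_apply_of_autToGL_eq_one h, ← mon_eq_of]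
  refine eq_of_coord (Module.toAddMonoidEnd LaurentRing LaurentRing) (twistedFox σ h) ?_
    ⟨_, comm₂_mem⟩ rfl ⟨w, hw⟩ ha
  intro g v v' hv
  change fox (σ v') = mon g * fox (σ v)
  rw [hv, map_mul, map_mul, map_inv, fox_conj, hm]
  rw [hm, mem_commutator_iff_mon.1 v.2]

/-- An automorphism acting trivially on the abelianization sends the basic commutator to a
conjugate, modulo the second derived subgroup. -/
theorem exists_fox_comm₂_of_autToGL_eq_one {σ : MulAut F₂} (h : F₂.autToGL σ = 1) :
    ∃ g, fox (σ comm₂) = mon g * (X 0 - 1) := by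
  have hm (v : F₂) : mon (σ v) = mon v := by
    rw [mon_eq_of, ab_apply_of_autToGL_eq_one h, ← mon_eq_of]
  have hinv : F₂.autToGL σ⁻¹ = 1 := by rw [map_inv, h, inv_one]
  have hmem {τ : MulAut F₂} (h : F₂.autToGL τ = 1) : τ comm₂ ∈ commutator F₂ := by
    rw [mem_commutator_iff, ab_apply_of_autToGL_eq_one h, ← mem_commutator_iff]
    exact comm₂_mem
  obtain ⟨l, hl⟩ := exists_fox_eq (hmem h)
  obtain ⟨m, hm'⟩ := exists_fox_eq (hmem hinv)
  have h1 := twistedFox_eq_mul h (hmem hinv) hm'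
  rw [MulAut.apply_inv_self, fox_comm₂, hl] at h1
  have hX := X_sub_one_ne_zero 0
  -- The coordinates of the basic commutator under `σ` and `σ⁻¹` are inverse units.
  have hlm : l * m = 1 := mul_right_cancel₀ hX (by linear_combination -h1)
  have hdecomp (i : Fin 2) : ∃ e, fox (σ (FreeGroup.of i)) =
      e * (X 0 - 1) + fox (FreeGroup.of i) := by
    have hu : σ (FreeGroup.of i) * (FreeGroup.of i)⁻¹ ∈ commutator F₂ := by
      rw [mem_commutator_iff, map_mul, ab_apply_of_autToGL_eq_one h, ← map_mul, mul_inv_cancel,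
        map_one]
    obtain ⟨e, he⟩ := exists_fox_eq hu
    refine ⟨e, ?_⟩
    have := fox_mul (σ (FreeGroup.of i) * (FreeGroup.of i)⁻¹) (FreeGroup.of i)
    rw [inv_mul_cancel_right, mem_commutator_iff_mon.1 hu, he, one_mul] at this
    exact this
  obtain ⟨e, he⟩ := hdecomp 0
  obtain ⟨f, hf⟩ := hdecomp 1
  -- Expanding the commutator of the two images shows that `l` is one modulo the augmentation ideal,
  -- which excludes the units `-X^z`.
  have h2 : l = 1 + (1 - X 1) * e + (X 0 - 1) * f := by
    apply mul_right_cancel₀ hX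
    rw [← hl, map_commutatorElement, fox_commutator, he, hf, hm, hm, fox_of_zero, fox_of_one]
    ring
  have haug : aug l = 1 := by
    rw [h2]; simp [X, aug_mon]
  obtain ⟨z, hz⟩ := eq_of_of_mul_eq_one hlm haug
  obtain ⟨g, rfl⟩ := exists_ab_eq z
  exact ⟨g, by rw [hl, hz, mon_eq_of]⟩

/-- A lift of `S` to the free group that fixes the basic commutator. -/
def liftS : MulAut F₂ :=
  MonoidHom.toMulEquiv
    (FreeGroup.lift ![FreeGroup.of 0 * FreeGroup.of 1 * (FreeGroup.of 0)⁻¹, (FreeGroup.of 0)⁻¹])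
    (FreeGroup.lift ![(FreeGroup.of 1)⁻¹, FreeGroup.of 1 * FreeGroup.of 0 * (FreeGroup.of 1)⁻¹])
    (by refine FreeGroup.ext_hom _ _ fun i => ?_
        fin_cases i <;> simp [mul_assoc])
    (by refine FreeGroup.ext_hom _ _ fun i => ?_
        fin_cases i <;> simp [mul_assoc])

/-- A lift of `T` to the free group that fixes the basic commutator. -/
def liftT : MulAut F₂ :=
  MonoidHom.toMulEquiv
    (FreeGroup.lift ![FreeGroup.of 0, FreeGroup.of 1 * FreeGroup.of 0])
    (FreeGroup.lift ![FreeGroup.of 0, FreeGroup.of 1 * (FreeGroup.of 0)⁻¹])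
    (by refine FreeGroup.ext_hom _ _ fun i => ?_
        fin_cases i <;> simp [mul_assoc])
    (by refine FreeGroup.ext_hom _ _ fun i => ?_
        fin_cases i <;> simp [mul_assoc])

theorem liftS_comm₂ : liftS comm₂ = comm₂ := by
  simp [liftS, comm₂, commutatorElement_def, mul_assoc]

theorem liftT_comm₂ : liftT comm₂ = comm₂ := by
  simp [liftT, comm₂, commutatorElement_def, mul_assoc]

theorem autToGL_liftS : F₂.autToGL liftS = (ModularGroup.S : GL (Fin 2) ℤ) := by
  apply Units.ext
  ext i j
  change F₂.abMatrix liftS.toMonoidHom i j = ModularGroup.S.1 i j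
  fin_cases i <;> fin_cases j <;> simp [F₂.abMatrix, liftS, ModularGroup.S, F₂.ab_of]

theorem autToGL_liftT : F₂.autToGL liftT = (ModularGroup.T : GL (Fin 2) ℤ) := by
  apply Units.ext
  ext i j
  change F₂.abMatrix liftT.toMonoidHom i j = ModularGroup.T.1 i j
  fin_cases i <;> fin_cases j <;> simp [F₂.abMatrix, liftT, ModularGroup.T, F₂.ab_of]

/-- Every element of `SL₂(ℤ)` lifts to an automorphism fixing the basic commutator. -/
theorem exists_autToGL_eq (γ : SL(2, ℤ)) :
    ∃ σ : MulAut F₂, F₂.autToGL σ = (γ : GL (Fin 2) ℤ) ∧ σ comm₂ = comm₂ := by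
  have hγ : γ ∈ Subgroup.closure {ModularGroup.S, ModularGroup.T} := by
    rw [SpecialLinearGroup.SL2Z_generators]; trivial
  induction hγ using Subgroup.closure_induction with
  | mem x hx =>
    rcases hx with rfl | rfl
    · exact ⟨liftS, autToGL_liftS, liftS_comm₂⟩
    · exact ⟨liftT, autToGL_liftT, liftT_comm₂⟩
  | one => exact ⟨1, by simp, rfl⟩
  | mul x y _ _ hx hy =>
    obtain ⟨σ, hσ, hσ'⟩ := hx
    obtain ⟨τ, hτ, hτ'⟩ := hy
    exact ⟨σ * τ, by rw [map_mul, hσ, hτ, map_mul], by rw [MulAut.mul_apply, hτ', hσ']⟩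
  | inv x _ hx =>
    obtain ⟨σ, hσ, hσ'⟩ := hx
    refine ⟨σ⁻¹, by rw [map_inv, hσ, map_inv], ?_⟩
    conv_lhs => rw [← hσ', MulAut.inv_apply_self]

/-- An automorphism of determinant one sends the basic commutator to a conjugate, modulo the
second derived subgroup. -/
theorem exists_fox_comm₂ {σ : MulAut F₂} {γ : SL(2, ℤ)}
    (h : F₂.autToGL σ = (γ : GL (Fin 2) ℤ)) :
    ∃ g, fox (σ comm₂) = mon g * (X 0 - 1) := by
  obtain ⟨τ, hτ, hτ'⟩ := exists_autToGL_eq γ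
  have h1 : F₂.autToGL (σ * τ⁻¹) = 1 := by rw [map_mul, map_inv, h, hτ, mul_inv_cancel]
  obtain ⟨g, hg⟩ := exists_fox_comm₂_of_autToGL_eq_one h1
  refine ⟨g, ?_⟩
  rw [← hg, MulAut.mul_apply]
  conv_rhs => rw [← hτ', MulAut.inv_apply_self]

end F₂


/-! ### Congruences for the commutator equation. -/

section Congruences

variable {R : Type*} [CommRing R]

/-- Here `s`, `t` are the variables, `P`, `Q`, `U`, `W` stand for `s^p`, `t^q`, `s^p'`, `t^q'`, and
`NP` is the quotient `(P - 1) / (s - 1)`, and similarly for the others. The hypothesis `h` is the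
Fox derivative of the commutator of the two images; dividing by `s - 1` leaves a deformation of the
determinant `p q' - p' q`. -/
theorem commutator_coefficient_eq [IsDomain R] {s t P Q U W e f NP NQ NU NW : R}
    (hs : s - 1 ≠ 0) (hP : (s - 1) * NP = P - 1) (hU : (s - 1) * NU = U - 1)
    (hQ : (t - 1) * NQ = Q - 1) (hW : (t - 1) * NW = W - 1)
    (h : (1 - U * W) * (e * (s - 1) + P * NQ) + (P * Q - 1) * (f * (s - 1) + U * NW) = s - 1) :
    (1 - U * W) * e + (P * Q - 1) * f + (U * NP * NW - P * NU * NQ) = 1 := by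
  apply mul_left_cancel₀ hs
  linear_combination h + U * NW * hP - P * NQ * hU - P * U * NQ * hW + P * U * NW * hQ

/-- Modulo `J` the deformed determinant becomes one and cancels the right side, leaving the linear
Koszul relation. -/
theorem mem_of_commutator_coefficient_eq {J : Ideal R} {s t P Q U W e f NP NQ NU NW : R}
    (hP : P - s ∈ J) (hU : U - 1 ∈ J) (hQ : Q - 1 ∈ J) (hW : W - t ∈ J)
    (hNP : NP - 1 ∈ J) (hNU : NU ∈ J) (hNQ : NQ ∈ J) (hNW : NW - 1 ∈ J)
    (h : (1 - U * W) * e + (P * Q - 1) * f + (U * NP * NW - P * NU * NQ) = 1) :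
    (1 - t) * e + (s - 1) * f ∈ J := by
  rw [← Ideal.Quotient.eq] at hP hU hQ hW hNP hNW
  rw [← Ideal.Quotient.eq_zero_iff_mem] at hNU hNQ ⊢
  have h1 := congrArg (Ideal.Quotient.mk J) h
  simp only [map_add, map_sub, map_mul, map_one, hP, hU, hQ, hW, hNP, hNW, hNU, hNQ] at h1 ⊢
  linear_combination h1

/-- Modulo `t ^ M - 1` the sum consists of `N` equal blocks of length `M`, and `N` is zero. Each use
costs a factor `N` in the level. -/
theorem geom_sum_mem {J : Ideal R} {t : R} {M N : ℕ} (ht : t ^ M - 1 ∈ J) (hN : (N : R) ∈ J) :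
    ∑ i ∈ Finset.range (M * N), t ^ i ∈ J := by
  have key (K : ℕ) : ∑ i ∈ Finset.range (M * K), t ^ i - K * ∑ i ∈ Finset.range M, t ^ i ∈ J := by
    induction K with
    | zero => simp
    | succ K ih =>
      have h2 : t ^ (M * K) - 1 ∈ J := by
        rw [pow_mul]
        exact J.mem_of_dvd (sub_one_dvd_pow_sub_one _ _) ht
      have h3 : ∑ i ∈ Finset.range (M * (K + 1)), t ^ i =
          ∑ i ∈ Finset.range (M * K), t ^ i + t ^ (M * K) * ∑ i ∈ Finset.range M, t ^ i := by
        rw [mul_add, mul_one, Finset.sum_range_add, Finset.mul_sum]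
        simp_rw [pow_add]
      rw [h3]
      have h4 := J.add_mem ih (J.mul_mem_right (∑ i ∈ Finset.range M, t ^ i) h2)
      convert h4 using 1
      push_cast; ring
  have := J.add_mem (key N) (J.mul_mem_right (∑ i ∈ Finset.range M, t ^ i) hN)
  simpa using this

section Powers

variable {G : Type*} [Group G] {χ : G →* R} {g : G} {J : Ideal R} {M N : ℕ}

theorem dvd_zpow_sub_one {n : ℕ} {q : ℤ} (hq : (n : ℤ) ∣ q) :
    χ g ^ n - 1 ∣ χ (g ^ q) - 1 := by
  obtain ⟨b, rfl⟩ := hq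
  rw [zpow_mul, zpow_natCast, ← map_pow]
  exact LaurentRing.sub_one_dvd_zpow_sub_one χ _ b

theorem zpow_sub_one_mem (hJ : χ g ^ M - 1 ∈ J) {q : ℤ} (hq : ((M * N : ℕ) : ℤ) ∣ q) :
    χ (g ^ q) - 1 ∈ J :=
  J.mem_of_dvd (dvd_zpow_sub_one ((Int.natCast_dvd_natCast.2 (Dvd.intro N rfl)).trans hq)) hJ

theorem quotient_mem [IsDomain R] (hg : χ g - 1 ≠ 0) (hJ : χ g ^ M - 1 ∈ J) (hN : (N : R) ∈ J)
    {q : ℤ} (hq : ((M * N : ℕ) : ℤ) ∣ q) {a : R} (ha : (χ g - 1) * a = χ (g ^ q) - 1) : a ∈ J := by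
  obtain ⟨z, hz⟩ := dvd_zpow_sub_one (χ := χ) (g := g) hq
  have h : a = (∑ i ∈ Finset.range (M * N), χ g ^ i) * z := by
    apply mul_left_cancel₀ hg
    rw [ha, hz, ← mul_geom_sum, mul_assoc]
  rw [h]
  exact J.mul_mem_right _ (geom_sum_mem hJ hN)

theorem zpow_sub_self_mem (hJ : χ g ^ M - 1 ∈ J) {p : ℤ} (hp : ((M * N : ℕ) : ℤ) ∣ p - 1) :
    χ (g ^ p) - χ g ∈ J := by
  have h := J.mul_mem_left (χ g) (zpow_sub_one_mem (χ := χ) hJ hp)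
  rwa [mul_sub, mul_one, ← map_mul, ← zpow_one_add, add_sub_cancel] at h

theorem quotient_sub_one_mem [IsDomain R] (hg : χ g - 1 ≠ 0) (hJ : χ g ^ M - 1 ∈ J) (hN : (N : R) ∈ J)
    {p : ℤ} (hp : ((M * N : ℕ) : ℤ) ∣ p - 1) {a : R} (ha : (χ g - 1) * a = χ (g ^ p) - 1) :
    a - 1 ∈ J := by
  have hunit : χ g * χ g⁻¹ = 1 := by rw [← map_mul]; simp
  have h : χ (g ^ (p - 1)) = χ (g ^ p) * χ g⁻¹ := by rw [zpow_sub_one, map_mul]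
  have h1 : χ g⁻¹ * (a - 1) ∈ J := by
    refine quotient_mem hg hJ hN hp ?_
    rw [h]
    linear_combination χ g⁻¹ * ha - hunit
  have h2 := J.mul_mem_left (χ g) h1
  rwa [← mul_assoc, hunit, one_mul] at h2

end Powers

end Congruences

/-! ### Solving the Koszul relation for automorphisms congruent to the identity. -/

namespace LaurentRing

/-- Modulo torsion, the Koszul relation on `X 0 - 1` and `X 1 - 1` is exact up to passing to a
smaller level. -/
theorem exists_koszul {I : Ideal LaurentRing} {N : ℕ} (hN0 : N ≠ 0) (hN : (N : LaurentRing) ∈ I)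
    (hX : ∀ i, X i ^ N - 1 ∈ I) {e f : LaurentRing}
    (h : (1 - X 1) * e + (X 0 - 1) * f ∈ Ideal.span
      {X 0 ^ (N * N) - 1, X 1 ^ (N * N) - 1, (N : LaurentRing)}) :
    ∃ k, e - (X 0 - 1) * k ∈ I ∧ f - (X 1 - 1) * k ∈ I := by
  obtain ⟨p, y, hy, hpy⟩ := Ideal.mem_span_insert.1 h
  obtain ⟨q, r, hqr⟩ := Ideal.mem_span_pair.1 hy
  have hG (i : Fin 2) := geom_sum_mem (hX i) hN
  have hG' (i : Fin 2) := mul_geom_sum (X i) (N * N)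
  -- Factoring `X i ^ (N * N) - 1` as `X i - 1` times a geometric sum turns membership into a Koszul
  -- relation modulo `N`; the corrections to `e` and `f` lie in `I` by `hG`.
  have h1 : (X 1 - 1) * (-e - (∑ l ∈ Finset.range (N * N), X 1 ^ l) * q) =
      (X 0 - 1) * ((∑ l ∈ Finset.range (N * N), X 0 ^ l) * p - f) + ((N : ℤ) : LaurentRing) * r := by
    push_cast
    linear_combination hpy - hqr - p * hG' 0 - q * hG' 1
  obtain ⟨k, a, b, ha, hb⟩ := exists_of_mul_eq (by decide) (by exact_mod_cast hN0) h1
  push_cast at ha hb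
  refine ⟨-k, ?_, ?_⟩
  · have := I.add_mem (I.mul_mem_right q (hG 1)) (I.mul_mem_right a hN)
    rw [← I.neg_mem_iff] at this
    convert this using 1
    linear_combination -ha
  · have := I.sub_mem (I.mul_mem_right p (hG 0)) (I.mul_mem_right b hN)
    convert this using 1
    linear_combination -hb

end LaurentRing

namespace F₂

open LaurentRing
open scoped commutatorElement

theorem fox_zpow (w : F₂) (q : ℤ) : (mon w - 1) * fox (w ^ q) = (mon (w ^ q) - 1) * fox w := by
  have h := congrArg fox ((Commute.refl w).zpow_right q).eq
  rw [fox_mul, fox_mul] at h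
  linear_combination h

theorem fox_of_zero_zpow (p : ℤ) : fox (FreeGroup.of 0 ^ p) = 0 := by
  have h := fox_zpow (FreeGroup.of 0) p
  rw [fox_of_zero, mul_zero] at h
  exact (mul_eq_zero.1 h).resolve_left (X_sub_one_ne_zero 0)

theorem fox_of_one_zpow (q : ℤ) :
    (X 1 - 1) * fox (FreeGroup.of 1 ^ q) = mon (FreeGroup.of 1 ^ q) - 1 := by
  rw [X, fox_zpow, fox_of_one, mul_one]

/-- A word is determined by its exponent sums up to an element of the derived subgroup. -/
theorem exists_decomposition {w : F₂} (p q : ℤ) (h0 : (F₂.ab w).toAdd 0 = p)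
    (h1 : (F₂.ab w).toAdd 1 = q) : ∃ u ∈ commutator F₂, ∃ e, fox u = e * (X 0 - 1) ∧
      w = u * (FreeGroup.of 0 ^ p * FreeGroup.of 1 ^ q) ∧
      fox w = e * (X 0 - 1) + mon (FreeGroup.of 0 ^ p) * fox (FreeGroup.of 1 ^ q) ∧
      mon w = mon (FreeGroup.of 0 ^ p) * mon (FreeGroup.of 1 ^ q) := by
  have hab : F₂.ab w = F₂.ab (FreeGroup.of 0 ^ p * FreeGroup.of 1 ^ q) := by
    apply Multiplicative.toAdd.injective
    ext l
    fin_cases l <;> simp [F₂.ab_of, ← h0, ← h1]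
  have hu : w * (FreeGroup.of 0 ^ p * FreeGroup.of 1 ^ q)⁻¹ ∈ commutator F₂ := by
    rw [mem_commutator_iff, map_mul, hab, ← map_mul, mul_inv_cancel, map_one]
  obtain ⟨e, he⟩ := exists_fox_eq hu
  have hw : w = w * (FreeGroup.of 0 ^ p * FreeGroup.of 1 ^ q)⁻¹ *
    (FreeGroup.of 0 ^ p * FreeGroup.of 1 ^ q) := by group
  refine ⟨_, hu, e, he, hw, ?_, ?_⟩
  · conv_lhs => rw [hw]
    rw [fox_mul, he, mem_commutator_iff_mon.1 hu, fox_mul, fox_of_zero_zpow]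
    ring
  · rw [mon_eq_of, hab, ← mon_eq_of, map_mul]

/-- The coordinates of an endomorphism that preserves the basic commutator modulo the second
derived subgroup and is congruent to the identity. -/
theorem exists_coords_of_congr_one {σ : F₂ →* F₂} (hσ : fox (σ comm₂) = X 0 - 1) {N : ℕ}
    (hN0 : N ≠ 0)
    (hcong : ∀ i j, ((N * N * N : ℕ) : ℤ) ∣ F₂.abMatrix σ i j - (1 : Matrix (Fin 2) (Fin 2) ℤ) i j)
    {I : Ideal LaurentRing} (hN : (N : LaurentRing) ∈ I) (hX : ∀ i, X i ^ N - 1 ∈ I) :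
    ∃ (k : LaurentRing) (u v : F₂) (e f : LaurentRing) (p q p' q' : ℤ),
      u ∈ commutator F₂ ∧ v ∈ commutator F₂ ∧
      fox u = e * (X 0 - 1) ∧ fox v = f * (X 0 - 1) ∧
      e - (X 0 - 1) * k ∈ I ∧ f - (X 1 - 1) * k ∈ I ∧
      (N : ℤ) ∣ p - 1 ∧ (N : ℤ) ∣ q ∧ (N : ℤ) ∣ p' ∧ (N : ℤ) ∣ q' - 1 ∧
      σ (FreeGroup.of 0) = u * (FreeGroup.of 0 ^ p * FreeGroup.of 1 ^ q) ∧
      σ (FreeGroup.of 1) = v * (FreeGroup.of 0 ^ p' * FreeGroup.of 1 ^ q') := by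
  obtain ⟨u, hu, e, he, hσu, hfu, hmu⟩ := exists_decomposition (w := σ (FreeGroup.of 0)) _ _ rfl rfl
  obtain ⟨v, hv, f, hf, hσv, hfv, hmv⟩ := exists_decomposition (w := σ (FreeGroup.of 1)) _ _ rfl rfl
  have hp := hcong 0 0
  have hq := hcong 1 0
  have hp' := hcong 0 1
  have hq' := hcong 1 1
  simp only [F₂.abMatrix, Matrix.of_apply, Matrix.one_apply_eq, Matrix.one_apply_ne, ne_eq,
    one_ne_zero, zero_ne_one, not_false_eq_true, sub_zero] at hp hq hp' hq'
  generalize (F₂.ab (σ (FreeGroup.of 0))).toAdd 0 = p at *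
  generalize (F₂.ab (σ (FreeGroup.of 0))).toAdd 1 = q at *
  generalize (F₂.ab (σ (FreeGroup.of 1))).toAdd 0 = p' at *
  generalize (F₂.ab (σ (FreeGroup.of 1))).toAdd 1 = q' at *
  have hdvd : (N : ℤ) ∣ ((N * N * N : ℕ) : ℤ) := by
    exact_mod_cast Dvd.intro_left (N * N) rfl
  obtain ⟨NP, hNP⟩ := sub_one_dvd_zpow_sub_one mon (FreeGroup.of (0 : Fin 2)) p
  obtain ⟨NU, hNU⟩ := sub_one_dvd_zpow_sub_one mon (FreeGroup.of (0 : Fin 2)) p'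
  have hrel := hσ
  rw [map_commutatorElement, fox_commutator, hfu, hfv, hmu, hmv] at hrel
  have hcoef := commutator_coefficient_eq (X_sub_one_ne_zero 0) hNP.symm hNU.symm
    (fox_of_one_zpow q) (fox_of_one_zpow q') hrel
  -- Exponents modulo `N³` control the quotients modulo this ideal of level `N²`, and the Koszul
  -- step then descends from level `N²` to `I`, of level `N`. This is the source of the cube.
  set J : Ideal LaurentRing := Ideal.span
    {X 0 ^ (N * N) - 1, X 1 ^ (N * N) - 1, (N : LaurentRing)} with hJ
  have hJ0 : X 0 ^ (N * N) - 1 ∈ J := Ideal.subset_span (by simp)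
  have hJ1 : X 1 ^ (N * N) - 1 ∈ J := Ideal.subset_span (by simp)
  have hJN : (N : LaurentRing) ∈ J := Ideal.subset_span (by simp)
  have hmem := mem_of_commutator_coefficient_eq (zpow_sub_self_mem hJ0 hp)
    (zpow_sub_one_mem hJ0 hp') (zpow_sub_one_mem hJ1 hq) (zpow_sub_self_mem hJ1 hq')
    (quotient_sub_one_mem (X_sub_one_ne_zero 0) hJ0 hJN hp hNP.symm)
    (quotient_mem (X_sub_one_ne_zero 0) hJ0 hJN hp' hNU.symm)
    (quotient_mem (X_sub_one_ne_zero 1) hJ1 hJN hq (fox_of_one_zpow q))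
    (quotient_sub_one_mem (X_sub_one_ne_zero 1) hJ1 hJN hq' (fox_of_one_zpow q')) hcoef
  obtain ⟨k, hk, hk'⟩ := exists_koszul hN0 hN hX hmem
  exact ⟨k, u, v, e, f, p, q, p', q', hu, hv, he, hf, hk, hk', hdvd.trans hp, hdvd.trans hq,
    hdvd.trans hp', hdvd.trans hq', hσu, hσv⟩

end F₂


/-! ### Evaluation in a finite metabelian group. -/

namespace F₂

open LaurentRing
open scoped commutatorElement IsMulCommutative

section Evaluation

variable {G : Type*} [Group G]

theorem map_mem_commutator (φ : F₂ →* G) {w : F₂} (hw : w ∈ commutator F₂) :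
    φ w ∈ commutator G := by
  have h : (commutator F₂).map φ ≤ commutator G := by
    rw [commutator_def, Subgroup.map_commutator]
    exact Subgroup.commutator_mono le_top le_top
  exact h (Subgroup.mem_map_of_mem φ hw)

variable [IsMulCommutative (commutator G)]

/-- The conjugation action on the derived subgroup, as additive endomorphisms. -/
def conjEnd : G →* AddMonoid.End (Additive (commutator G)) where
  toFun g := MonoidHom.toAdditive (MulAut.conjNormal g : MulAut (commutator G)).toMonoidHom
  map_one' := by rw [map_one]; rfl
  map_mul' g h := by rw [map_mul]; rfl

theorem coe_conjEnd (g : G) (a : Additive (commutator G)) :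
    (((conjEnd g a).toMul : commutator G) : G) = g * (a.toMul : commutator G) * g⁻¹ := rfl

theorem conjEnd_eq_one {g : G} (hg : g ∈ commutator G) : conjEnd g = 1 := by
  ext a
  have h : g * (a.toMul : commutator G) = (a.toMul : commutator G) * g :=
    congrArg Subtype.val (mul_comm (⟨g, hg⟩ : commutator G) a.toMul)
  rw [coe_conjEnd, h, mul_inv_cancel_right]
  rfl

/-- `G'` is abelian, so it acts trivially on itself and conjugation through `φ` depends only on
exponent sums. -/
theorem conjEnd_congr (φ : F₂ →* G) {v w : F₂} (h : F₂.ab v = F₂.ab w) :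
    conjEnd (φ v) = conjEnd (φ w) := by
  have hmem : v * w⁻¹ ∈ commutator F₂ := by
    rw [mem_commutator_iff, map_mul, h, ← map_mul, mul_inv_cancel, map_one]
  have := conjEnd_eq_one (map_mem_commutator φ hmem)
  rw [← inv_mul_cancel_right v w, map_mul φ, map_mul, this, one_mul]

/-- The action of exponent vectors on the derived subgroup through ordered monomials. -/
def conjExp (φ : F₂ →* G) :
    Multiplicative (Fin 2 → ℤ) →* AddMonoid.End (Additive (commutator G)) where
  toFun z := conjEnd (φ (FreeGroup.of 0 ^ z.toAdd 0 * FreeGroup.of 1 ^ z.toAdd 1))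
  map_one' := by simp
  map_mul' y z := by
    rw [← map_mul, ← map_mul]
    exact conjEnd_congr φ (by
      apply Multiplicative.toAdd.injective
      ext l
      fin_cases l <;> simp [F₂.ab_of])

theorem conjExp_ab (φ : F₂ →* G) (w : F₂) : conjExp φ (F₂.ab w) = conjEnd (φ w) :=
  conjEnd_congr φ (by
    apply Multiplicative.toAdd.injective
    ext l
    fin_cases l <;> simp [F₂.ab_of])

/-- The Laurent ring acts on the derived subgroup of a metabelian group through a homomorphism
from the free group. -/
noncomputable def eval (φ : F₂ →* G) : LaurentRing →+* AddMonoid.End (Additive (commutator G)) :=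
  (MonoidAlgebra.lift ℤ (AddMonoid.End (Additive (commutator G))) (Multiplicative (Fin 2 → ℤ))
    (conjExp φ)).toRingHom

theorem eval_mon (φ : F₂ →* G) (w : F₂) : eval φ (mon w) = conjEnd (φ w) :=
  (MonoidAlgebra.lift_of _ _).trans (conjExp_ab φ w)

/-- The restriction of a homomorphism to the derived subgroups. -/
def restrict (φ : F₂ →* G) : commutator F₂ →* Multiplicative (Additive (commutator G)) where
  toFun w := Multiplicative.ofAdd (Additive.ofMul ⟨φ w, map_mem_commutator φ w.2⟩)
  map_one' := congrArg (fun a => Multiplicative.ofAdd (Additive.ofMul a)) (Subtype.ext (map_one φ))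
  map_mul' v w := congrArg (fun a => Multiplicative.ofAdd (Additive.ofMul a))
    (Subtype.ext (map_mul φ (v : F₂) w))

theorem restrict_eq_eval (φ : F₂ →* G) {w : F₂} (hw : w ∈ commutator F₂) {a : LaurentRing}
    (ha : fox w = a * (X 0 - 1)) :
    Additive.ofMul ⟨φ w, map_mem_commutator φ hw⟩ =
      eval φ a (Additive.ofMul ⟨φ comm₂, map_mem_commutator φ comm₂_mem⟩) := by
  refine eq_of_coord (eval φ) (restrict φ) ?_ ⟨_, comm₂_mem⟩ rfl ⟨w, hw⟩ ha
  intro g v v' hv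
  rw [eval_mon]
  apply Additive.toMul.injective
  apply Subtype.ext
  rw [coe_conjEnd]
  change φ v' = φ g * φ v * (φ g)⁻¹
  rw [hv, map_mul, map_mul, map_inv]

/-- With `z = k · φ comm₂` and `x = φ (x_i)`, the congruence for `e` says `φ u = (x - 1) · z`, that
is `z⁻¹ (x z x⁻¹)`. The element `z` does not depend on `i`, so it conjugates both generators at
once. -/
theorem conj_of_coord (φ : F₂ →* G) {u : F₂} (hu : u ∈ commutator F₂) {e k : LaurentRing} (i : Fin 2)
    (he : fox u = e * (X 0 - 1)) (hk : e - (X i - 1) * k ∈ RingHom.ker (eval φ)) :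
    φ u * φ (FreeGroup.of i) =
      (((eval φ k (Additive.ofMul ⟨φ comm₂, map_mem_commutator φ comm₂_mem⟩)).toMul :
        commutator G) : G)⁻¹ * φ (FreeGroup.of i) *
      ((eval φ k (Additive.ofMul ⟨φ comm₂, map_mem_commutator φ comm₂_mem⟩)).toMul :
        commutator G) := by
  have h1 := restrict_eq_eval φ hu he
  have h2 : eval φ e = (eval φ (X i) - 1) * eval φ k := by
    rw [RingHom.mem_ker, map_sub, sub_eq_zero] at hk
    rw [hk, map_mul, map_sub, map_one]
  rw [h2, eval_mon] at h1
  change _ = (conjEnd (φ (FreeGroup.of i)) - 1) (eval φ k _) at h1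
  generalize eval φ k (Additive.ofMul ⟨φ comm₂, map_mem_commutator φ comm₂_mem⟩) = z at *
  have h3 : Additive.ofMul ⟨φ u, map_mem_commutator φ hu⟩ = -z + conjEnd (φ (FreeGroup.of i)) z := by
    rw [h1, ← sub_eq_neg_add]
    rfl
  have h4 := congrArg (fun z : Additive (commutator G) => ((z.toMul : commutator G) : G)) h3
  change φ u = (z.toMul : commutator G)⁻¹ * (((conjEnd (φ (FreeGroup.of i)) z).toMul :
    commutator G) : G) at h4
  rw [h4, coe_conjEnd, InvMemClass.coe_inv]
  group

theorem eval_ker_of_card [Finite G] (φ : F₂ →* G) :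
    (Nat.card G : LaurentRing) ∈ RingHom.ker (eval φ) ∧
      ∀ i, X i ^ Nat.card G - 1 ∈ RingHom.ker (eval φ) := by
  constructor
  · rw [RingHom.mem_ker, map_natCast]
    ext a
    have : (Nat.card G : AddMonoid.End (Additive (commutator G))) a = Nat.card G • a := by simp
    rw [this]
    change ((a.toMul : commutator G) : G) ^ Nat.card G = 1
    exact pow_card_eq_one'
  · intro i
    rw [RingHom.mem_ker, map_sub, map_pow, X, eval_mon, ← map_pow, pow_card_eq_one', map_one,
      map_one, sub_self]

theorem exists_conj_of_congr_one [Finite G] (φ : F₂ →* G) {σ : F₂ →* F₂}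
    (hσ : fox (σ comm₂) = X 0 - 1)
    (hcong : ∀ i j, ((Nat.card G * Nat.card G * Nat.card G : ℕ) : ℤ) ∣
      F₂.abMatrix σ i j - (1 : Matrix (Fin 2) (Fin 2) ℤ) i j) :
    ∃ z : G, ∀ w, φ (σ w) = z * φ w * z⁻¹ := by
  obtain ⟨hN, hX⟩ := eval_ker_of_card φ
  obtain ⟨k, u, v, e, f, p, q, p', q', hu, hv, he, hf, hk, hk', hp, hq, hp', hq', h0, h1⟩ :=
    exists_coords_of_congr_one hσ Nat.card_pos.ne' hcong hN hX
  set z : G := (((eval φ k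
    (Additive.ofMul ⟨φ comm₂, map_mem_commutator φ comm₂_mem⟩)).toMul : commutator G) : G)
  have hpow (g : G) {n : ℤ} (hn : (Nat.card G : ℤ) ∣ n) : g ^ n = 1 := by
    obtain ⟨m, rfl⟩ := hn
    rw [zpow_mul, zpow_natCast, pow_card_eq_one', one_zpow]
  have hpow' (g : G) {n : ℤ} (hn : (Nat.card G : ℤ) ∣ n - 1) : g ^ n = g := by
    have := hpow g hn
    rwa [zpow_sub_one, mul_inv_eq_one] at this
  refine ⟨z⁻¹, fun w => ?_⟩
  have hhom : φ.comp σ = (MulAut.conj z⁻¹).toMonoidHom.comp φ := by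
    refine FreeGroup.ext_hom _ _ fun i => ?_
    fin_cases i
    · change φ (σ (FreeGroup.of 0)) = z⁻¹ * φ (FreeGroup.of 0) * z⁻¹⁻¹
      rw [h0, map_mul, map_mul, map_zpow, map_zpow, hpow _ hq, hpow' _ hp, mul_one,
        conj_of_coord φ hu 0 he hk, inv_inv]
    · change φ (σ (FreeGroup.of 1)) = z⁻¹ * φ (FreeGroup.of 1) * z⁻¹⁻¹
      rw [h1, map_mul, map_mul, map_zpow, map_zpow, hpow _ hp', hpow' _ hq', one_mul,
        conj_of_coord φ hv 1 hf hk', inv_inv]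
  exact DFunLike.congr_fun hhom w

end Evaluation

/-- An automorphism congruent to the identity modulo a suitable integer acts on homomorphisms to a
finite metabelian group by conjugation. -/
theorem exists_conj_of_mem_Gamma {G : Type*} [Group G] [Finite G] (hG : IsMetabelian G)
    (φ : F₂ →* G) {σ : MulAut F₂} {γ : SL(2, ℤ)} (hσ : F₂.autToGL σ = (γ : GL (Fin 2) ℤ))
    (hγ : γ ∈ CongruenceSubgroup.Gamma (Nat.card G * Nat.card G * Nat.card G)) :
    ∃ z : G, ∀ w, φ (σ w) = z * φ w * z⁻¹ := by
  have : IsMulCommutative (commutator G) := IsMulCommutative.of_setLike_mul_comm hG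
  obtain ⟨g, hg⟩ := exists_fox_comm₂ hσ
  -- The inner correction removes the monomial `mon g` without changing the matrix.
  set τ : MulAut F₂ := MulAut.conj g⁻¹ * σ with hτ
  have hτσ : F₂.autToGL τ = (γ : GL (Fin 2) ℤ) := by
    have : F₂.autToGL (MulAut.conj g⁻¹) = 1 := F₂.inn_le_ker ⟨_, rfl⟩
    rw [hτ, map_mul, this, one_mul, hσ]
  have hfox : fox (τ.toMonoidHom comm₂) = X 0 - 1 := by
    change fox (g⁻¹ * σ comm₂ * g⁻¹⁻¹) = _
    rw [fox_conj, hg, ← mul_assoc, mon_inv_mul, one_mul]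
    rw [map_commutatorElement, mon_commutator]
  obtain ⟨z, hz⟩ := exists_conj_of_congr_one φ hfox (by
    intro i j
    rw [abMatrix_of_autToGL hτσ, ← ZMod.intCast_eq_intCast_iff_dvd_sub]
    obtain ⟨h00, h01, h10, h11⟩ := CongruenceSubgroup.Gamma_mem.1 hγ
    fin_cases i <;> fin_cases j
    · exact (Int.cast_one).trans h00.symm
    · exact (Int.cast_zero).trans h01.symm
    · exact (Int.cast_zero).trans h10.symm
    · exact (Int.cast_one).trans h11.symm)
  refine ⟨φ g * z, fun w => ?_⟩
  have h1 : σ w = g * τ.toMonoidHom w * g⁻¹ := by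
    change σ w = g * (g⁻¹ * σ w * g⁻¹⁻¹) * g⁻¹
    group
  rw [h1, map_mul, map_mul, hz, map_inv]
  group

end F₂

/-! ### The action on `Epi^ext(F₂, G)` and its stabilizers. -/

theorem EpiExt.aut_smul_eq_self {G : Type*} [Group G] [Finite G] (hG : IsMetabelian G)
    {σ : MulAut F₂} {γ : SL(2, ℤ)} (hσ : F₂.autToGL σ = (γ : GL (Fin 2) ℤ))
    (hγ : γ ∈ CongruenceSubgroup.Gamma (Nat.card G * Nat.card G * Nat.card G))
    (x : EpiExt F₂ G) : σ • x = x := by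
  -- The action precomposes with the inverse, so `σ⁻¹` gives the class of `φ ∘ σ`.
  rw [eq_comm, ← inv_smul_eq_iff]
  obtain ⟨φ, hφ⟩ := x
  obtain ⟨z, hz⟩ := F₂.exists_conj_of_mem_Gamma hG φ hσ hγ
  refine (Quotient.sound ((epiSetoid F₂ G).symm ⟨z, fun b => ?_⟩) :
    Quotient.mk (epiSetoid F₂ G) _ = Quotient.mk _ _)
  exact hz b

theorem EpiExt.out_smul_eq_self {G : Type*} [Group G] [Finite G] (hG : IsMetabelian G)
    {o : OuterAut F₂} {γ : SL(2, ℤ)} (ho : F₂.outToGL o = (γ : GL (Fin 2) ℤ))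
    (hγ : γ ∈ CongruenceSubgroup.Gamma (Nat.card G * Nat.card G * Nat.card G))
    (x : EpiExt F₂ G) : o • x = x := by
  obtain ⟨σ, rfl⟩ := QuotientGroup.mk_surjective o
  exact EpiExt.aut_smul_eq_self hG ho hγ x

theorem mainTheorem2 {G : Type*} [Group G] [Finite G] (hG : IsMetabelian G)
    (h2 : ∃ a b : G, Subgroup.closure {a, b} = ⊤) :
    -- every element of `SL₂(ℤ) ⊆ GL₂(ℤ)` is induced by an outer automorphism of `F₂`
    (∀ γ : SL(2, ℤ), ∃ o : OuterAut F₂, F₂.outToGL o = (γ : GL (Fin 2) ℤ)) ∧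
    -- `SL₂(ℤ)` acts on `Epi^ext(F₂, G)` through these outer automorphisms
    ∃ _act : MulAction SL(2, ℤ) (EpiExt F₂ G),
      (∀ (γ : SL(2, ℤ)) (o : OuterAut F₂), F₂.outToGL o = (γ : GL (Fin 2) ℤ) →
        ∀ x : EpiExt F₂ G, γ • x = o • x) ∧
      -- the stabilizers are congruence subgroups
      ∀ (φ : F₂ →* G) (hφ : Function.Surjective φ),
        CongruenceSubgroup.IsCongruenceSubgroup
          (MulAction.stabilizer SL(2, ℤ) (EpiExt.mk φ hφ)) := by
  have hlift (γ : SL(2, ℤ)) : ∃ o : OuterAut F₂, F₂.outToGL o = (γ : GL (Fin 2) ℤ) := by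
    obtain ⟨σ, hσ, -⟩ := F₂.exists_autToGL_eq γ
    exact ⟨QuotientGroup.mk σ, hσ⟩
  refine ⟨hlift, ?_⟩
  -- Two lifts differ by an outer automorphism over `1`, which lies in every `Γ(n)` and so acts
  -- trivially.
  have hwd {o o' : OuterAut F₂} (h : F₂.outToGL o = F₂.outToGL o') (x : EpiExt F₂ G) :
      o • x = o' • x := by
    rw [← inv_smul_eq_iff, smul_smul]
    refine EpiExt.out_smul_eq_self hG (γ := 1) ?_ (one_mem _) x
    rw [map_mul, map_inv, h, inv_mul_cancel, map_one]
  choose s hs using hlift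
  let act : MulAction SL(2, ℤ) (EpiExt F₂ G) :=
    { smul := fun γ x => s γ • x
      one_smul := fun x => by
        change s 1 • x = x
        rw [hwd (o' := 1) (by rw [hs, map_one, map_one]) x, one_smul]
      mul_smul := fun γ γ' x => by
        change s (γ * γ') • x = s γ • s γ' • x
        rw [smul_smul]
        exact hwd (by rw [hs, map_mul, map_mul, hs, hs]) x }
  refine ⟨act, fun γ o ho x => hwd ((hs γ).trans ho.symm) x, fun φ hφ => ?_⟩
  have hcard := Nat.card_pos (α := G)
  exact ⟨Nat.card G * Nat.card G * Nat.card G, by positivity, fun γ hγ =>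
    EpiExt.out_smul_eq_self hG (hs γ) hγ _⟩
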